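/- For a finite field $\mathbb{F}_q$ and $x=(x_1,x_2)\in\mathbb{F}_q^2$ write $\|x\|=x_1^2+x_2^2\in\mathbb{F}_q$. Call $U\subseteq\mathbb{F}_q^2$ a distinct distance subset if no two different unordered pairs of distinct points of $U$ determine the same distance, i.e. if $x,y,z,t\in U$, $x\ne y$, $z\ne t$ and $\|x-y\|=\|z-t\|$, then $\{x,y\}=\{z,t\}$. (In particular there are no four distinct points $x,y,z,t\in U$ with $\|x-y\|=\|z-t\|$.) There is an absolute constant $C_2>0$ such that for every $c>0$ there is a constant $c_1>0$, depending only on $c$, with the following property. For every odd prime power $q$ and every $E\subseteq\mathbb{F}_q^2$ with $|E|\ge c\,q^{4/3}$, there is a distinct distance subset $U\subseteq E$ with $$c_1\,q^{1/3}\le |U|\le C_2\,q^{1/2}.$$ -/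

import Mathlib

/-- The "norm" `‖x‖ = x₁² + ⋯ + x_d²` of a vector over a field (an element of the field). -/
def ffNorm {F : Type*} [Field F] {d : ℕ} (x : Fin d → F) : F :=
  ∑ i, x i ^ 2

/-- `U` is a distinct distance subset: two different unordered pairs `{x, y}`, `{z, t}` of distinct
points of `U` (disjoint or sharing a point) never determine the same distance. -/
def IsDistinctDistanceSet {F : Type*} [Field F] {d : ℕ} (U : Finset (Fin d → F)) : Prop :=
  ∀ x ∈ U, ∀ y ∈ U, ∀ z ∈ U, ∀ t ∈ U, x ≠ y → z ≠ t →
    ffNorm (x - y) = ffNorm (z - t) → (x = z ∧ y = t) ∨ (x = t ∧ y = z)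

/-!
A point set `E` in the plane over a field of odd order `q`, with `N = #E ≥ c q ^ (4/3)`, contains
few coincidences among its distances, and the deletion method turns this into a large subset without
any. Three kinds of coincidence occur between two different pairs of distinct points.

* Pairs at distance zero. Isotropic lines can make zero a very popular distance, so all pairs at
  distance zero are removed; there are at most `2qN` of them (`distCount_zero_le`).
* Isosceles triangles. The bisector of two points is a line, so the variance of the pinned distance
  counts over all pins in the plane is at most `q²N`, and there are `O(N³/q + q²N)` isosceles
  triangles with vertices in `E` (`sum_pinCount_sq_le`).
* Two disjoint pairs at the same nonzero distance. There are `O(N⁴/q + q N^(5/2))` of them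
  (`sum_distCount_sq_ne_zero_le`).

The last bound is the analytic part. Gauss sums show that the Fourier transform of the distance
distribution `d ↦ distCount E d` and that of the distribution `r ↦ energy χ E r` of the Fourier
energy of `E` over circles agree in absolute value, up to the factor `q`, after the substitution
`a ↦ -(4a)⁻¹`. By Parseval the second moments of the two distributions are then comparable
(`sum_distCount_sq_le`). The energy at `r = 0` is absorbed by the zero distances
(`energy_zero_le`). For `r ≠ 0` the circle is a Sidon set up to antipodal pairs, which gives an `L⁴`
extension estimate and, by duality, `energy χ E r ≤ √3 q N^(3/2)` (`energy_sq_le`); the total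
energy is `q² N`.

A random subset of `E` of density `δ q^(1/3) / N` has `δ q^(1/3)` points on average and, for small
`δ` depending on `c`, at most half as many coincidences (`expected_coincidences_le`), so that
removing a point from each leaves enough (`exists_subset_avoiding`). The upper bound on the size
holds for every distinct distance set, since its unordered pairs of points have
different distances in `F`.
-/

namespace FiniteFieldDistance

open Finset ComplexConjugate

/-! ### Fourier analysis on the plane and distances -/

section Fourier

variable {F : Type*} [Field F]

/-- The quadratic form `x₁² + x₂²` on the plane `F × F`. -/
def qnorm (x : F × F) : F := x.1 ^ 2 + x.2 ^ 2

/-- The standard bilinear form on the plane `F × F`. -/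
def dot (x y : F × F) : F := x.1 * y.1 + x.2 * y.2

lemma dot_sub_right (x y z : F × F) : dot x (y - z) = dot x y - dot x z := by
  simp [dot]; ring

/-- The substitution relating quadratic phases to their Fourier transforms. With `0⁻¹ = 0` it is a
bijection of the whole field that fixes `0`. -/
lemma involutive_neg_inv_four_mul (h2 : (2 : F) ≠ 0) :
    Function.Involutive fun s : F => -(4 * s)⁻¹ := fun s => by
  have h4 : (4 : F) ≠ 0 := by rw [show (4 : F) = 2 * 2 by norm_num]; exact mul_ne_zero h2 h2
  by_cases hs : s = 0
  · simp [hs]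
  · field_simp

variable [Fintype F]

/-- The two-dimensional quadratic Gauss sum. -/
noncomputable def gaussSum₂ (χ : AddChar F ℂ) (a : F) : ℂ := ∑ ξ, χ (a * qnorm ξ)

/-- Completing the square: the Fourier transform of a quadratic phase is a quadratic phase. -/
lemma sum_char_quadratic (h2 : (2 : F) ≠ 0) (χ : AddChar F ℂ) {a : F} (ha : a ≠ 0) (v : F × F) :
    ∑ ξ, χ (a * qnorm ξ + dot ξ v) = gaussSum₂ χ a * χ (-(4 * a)⁻¹ * qnorm v) := by
  rw [gaussSum₂, sum_mul, ← Equiv.sum_comp (Equiv.subRight ((2 * a)⁻¹ • v))]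
  refine sum_congr rfl fun ξ _ => ?_
  rw [← AddChar.map_add_eq_mul]
  congr 1
  have h4 : (4 : F) ≠ 0 := by rw [show (4 : F) = 2 * 2 by norm_num]; exact mul_ne_zero h2 h2
  simp [qnorm, dot]
  field_simp
  ring

/-- The unnormalised Fourier transform of the indicator function of `E`. -/
noncomputable def ft (χ : AddChar F ℂ) (E : Finset (F × F)) (ξ : F × F) : ℂ :=
  ∑ x ∈ E, χ (dot ξ x)

/-- `‖ft χ E ξ‖ ^ 2` is the Fourier transform of the difference multiset of `E`, so pairing it with a
quadratic phase gives a quadratic phase summed over the differences. -/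
lemma sum_norm_ft_mul_char (h2 : (2 : F) ≠ 0) (χ : AddChar F ℂ) (E : Finset (F × F)) {a : F}
    (ha : a ≠ 0) :
    ∑ ξ, ((‖ft χ E ξ‖ ^ 2 : ℝ) : ℂ) * χ (a * qnorm ξ) =
      gaussSum₂ χ a * ∑ p ∈ E ×ˢ E, χ (-(4 * a)⁻¹ * qnorm (p.1 - p.2)) := by
  simp only [mul_sum, ← sum_char_quadratic h2 χ ha]
  rw [sum_comm]
  refine sum_congr rfl fun ξ _ => ?_
  rw [Complex.ofReal_pow, ← Complex.mul_conj', ft, map_sum, sum_mul_sum, ← sum_product', sum_mul]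
  refine sum_congr rfl fun p _ => ?_
  rw [← AddChar.map_neg_eq_conj, ← AddChar.map_add_eq_mul, ← AddChar.map_add_eq_mul,
    dot_sub_right]
  congr 1; ring

variable [DecidableEq F]

lemma sum_char {χ : AddChar F ℂ} (hχ : χ.IsPrimitive) (a : F) :
    ∑ t, χ (t * a) = if a = 0 then (Fintype.card F : ℂ) else 0 := by
  rw [AddChar.sum_mulShift a hχ]; split_ifs <;> simp

lemma sum_char_dot {χ : AddChar F ℂ} (hχ : χ.IsPrimitive) (v : F × F) :
    ∑ x, χ (dot x v) = if v = 0 then (Fintype.card F : ℂ) ^ 2 else 0 := by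
  simp only [dot, Fintype.sum_prod_type, AddChar.map_add_eq_mul, ← mul_sum, ← sum_mul,
    sum_char hχ, Prod.ext_iff, Prod.fst_zero, Prod.snd_zero]
  by_cases h1 : v.1 = 0 <;> by_cases h2 : v.2 = 0 <;> simp [h1, h2, sq]

/-- Parseval's identity for a finite matrix `e` with orthogonal columns of equal norm. -/
lemma parseval {α β : Type*} [Fintype α] [Fintype β] [DecidableEq β] (e : α → β → ℂ) (M : ℝ)
    (he : ∀ s t, ∑ x, e x s * conj (e x t) = if s = t then (M : ℂ) else 0) (H : β → ℂ) :
    ∑ x, ‖∑ s, H s * e x s‖ ^ 2 = M * ∑ s, ‖H s‖ ^ 2 := by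
  have key : ((∑ x, ‖∑ s, H s * e x s‖ ^ 2 : ℝ) : ℂ) = ((M * ∑ s, ‖H s‖ ^ 2 : ℝ) : ℂ) := by
    push_cast
    simp only [← Complex.mul_conj', map_sum, map_mul, sum_mul_sum]
    rw [sum_comm]
    calc ∑ s, ∑ x, ∑ t, H s * e x s * (conj (H t) * conj (e x t))
        = ∑ s, ∑ t, H s * conj (H t) * ∑ x, e x s * conj (e x t) := by
          refine sum_congr rfl fun s _ => ?_
          rw [sum_comm]
          refine sum_congr rfl fun t _ => ?_
          rw [mul_sum]
          exact sum_congr rfl fun x _ => by ring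
      _ = _ := by
          simp only [he, mul_ite, mul_zero, sum_ite_eq, mem_univ, if_true, mul_sum]
          exact sum_congr rfl fun s _ => by ring
  exact_mod_cast key

lemma parseval_line {χ : AddChar F ℂ} (hχ : χ.IsPrimitive) (H : F → ℂ) :
    ∑ x, ‖∑ s, H s * χ (x * s)‖ ^ 2 = Fintype.card F * ∑ s, ‖H s‖ ^ 2 := by
  refine parseval (fun x s => χ (x * s)) _ (fun s t => ?_) H
  simp only [← AddChar.map_neg_eq_conj, ← AddChar.map_add_eq_mul, ← sub_eq_add_neg, ← mul_sub,
    sum_char hχ, sub_eq_zero]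
  simp

lemma parseval_plane {χ : AddChar F ℂ} (hχ : χ.IsPrimitive) (H : F × F → ℂ) :
    ∑ x, ‖∑ s, H s * χ (dot x s)‖ ^ 2 = (Fintype.card F : ℝ) ^ 2 * ∑ s, ‖H s‖ ^ 2 := by
  refine parseval (fun x s => χ (dot x s)) _ (fun s t => ?_) H
  simp only [← AddChar.map_neg_eq_conj, ← AddChar.map_add_eq_mul, ← sub_eq_add_neg,
    ← dot_sub_right, sum_char_dot hχ, sub_eq_zero]
  simp

/-- The Fourier energy of `E` on the circle of radius `r`. -/
noncomputable def energy (χ : AddChar F ℂ) (E : Finset (F × F)) (r : F) : ℝ :=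
  ∑ ξ with qnorm ξ = r, ‖ft χ E ξ‖ ^ 2

/-- The number of ordered pairs of points of `E` at distance `d`. -/
def distCount (E : Finset (F × F)) (d : F) : ℕ :=
  #{p ∈ E ×ˢ E | qnorm (p.1 - p.2) = d}

lemma energy_nonneg (χ : AddChar F ℂ) (E : Finset (F × F)) (r : F) : 0 ≤ energy χ E r :=
  sum_nonneg fun _ _ => by positivity

lemma sum_energy {χ : AddChar F ℂ} (hχ : χ.IsPrimitive) (E : Finset (F × F)) :
    ∑ r, energy χ E r = (Fintype.card F : ℝ) ^ 2 * #E := by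
  have h := parseval_plane hχ (fun s => if s ∈ E then 1 else 0)
  simp only [ite_mul, one_mul, zero_mul, ← sum_filter, filter_mem_eq_inter, univ_inter] at h
  rw [show ∑ r, energy χ E r = ∑ ξ, ‖ft χ E ξ‖ ^ 2 from sum_fiberwise _ _ _]
  simp only [ft]
  rw [h]
  congr 1
  have h1 : ∀ s, ‖if s ∈ E then (1 : ℂ) else 0‖ ^ 2 = if s ∈ E then (1 : ℝ) else 0 := fun s => by
    split_ifs <;> simp
  simp [h1]

lemma sum_distCount (E : Finset (F × F)) : ∑ d, distCount E d = #E ^ 2 := by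
  rw [sq, ← card_product]
  exact (card_eq_sum_card_fiberwise (fun _ _ => mem_coe.2 (mem_univ _))).symm

lemma sum_distCount_mul (E : Finset (F × F)) (g : F → ℂ) :
    ∑ d, (distCount E d : ℂ) * g d = ∑ p ∈ E ×ˢ E, g (qnorm (p.1 - p.2)) := by
  rw [← sum_fiberwise (E ×ˢ E) (fun p => qnorm (p.1 - p.2))]
  refine sum_congr rfl fun d _ => ?_
  rw [sum_congr rfl (g := fun _ => g d) (fun p hp => by rw [(mem_filter.1 hp).2])]
  simp [distCount]

lemma sum_energy_mul (χ : AddChar F ℂ) (E : Finset (F × F)) (g : F → ℂ) :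
    ∑ r, (energy χ E r : ℂ) * g r = ∑ ξ, ((‖ft χ E ξ‖ ^ 2 : ℝ) : ℂ) * g (qnorm ξ) := by
  rw [← sum_fiberwise univ qnorm]
  refine sum_congr rfl fun d _ => ?_
  rw [energy, Complex.ofReal_sum, sum_mul]
  exact sum_congr rfl fun p hp => by rw [(mem_filter.1 hp).2]

/-- Up to the Gauss sum, the Fourier transforms of `r ↦ energy χ E r` and of `distCount E`
agree after the substitution `a ↦ -(4a)⁻¹`. -/
lemma sum_energy_mul_char (h2 : (2 : F) ≠ 0) (χ : AddChar F ℂ) (E : Finset (F × F)) {a : F}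
    (ha : a ≠ 0) :
    ∑ r, (energy χ E r : ℂ) * χ (a * r) =
      gaussSum₂ χ a * ∑ d, (distCount E d : ℂ) * χ (-(4 * a)⁻¹ * d) := by
  rw [sum_energy_mul χ E fun r => χ (a * r), sum_distCount_mul E fun d => χ (-(4 * a)⁻¹ * d)]
  exact sum_norm_ft_mul_char h2 χ E ha

lemma norm_gaussSum₂ (h2 : (2 : F) ≠ 0) {χ : AddChar F ℂ} (hχ : χ.IsPrimitive) {a : F}
    (ha : a ≠ 0) : ‖gaussSum₂ χ a‖ = Fintype.card F := by
  have h1 : gaussSum₂ χ a = (∑ t, χ (a * t ^ 2)) ^ 2 := by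
    simp only [gaussSum₂, qnorm, Fintype.sum_prod_type, mul_add, AddChar.map_add_eq_mul, sq,
      sum_mul_sum]
  -- The substitution `x = h + y` makes the phase `x ^ 2 - y ^ 2` linear in `y`.
  have h3 : (((‖∑ t, χ (a * t ^ 2)‖ ^ 2 : ℝ)) : ℂ) = (Fintype.card F : ℝ) := by
    rw [Complex.ofReal_pow, ← Complex.conj_mul', map_sum, sum_mul_sum]
    calc ∑ y, ∑ x, conj (χ (a * y ^ 2)) * χ (a * x ^ 2)
        = ∑ y, ∑ h, χ (a * h ^ 2) * χ (y * (2 * a * h)) := by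
          refine sum_congr rfl fun y _ => ?_
          rw [← Equiv.sum_comp (Equiv.addRight y)]
          refine sum_congr rfl fun h _ => ?_
          rw [← AddChar.map_neg_eq_conj, ← AddChar.map_add_eq_mul, ← AddChar.map_add_eq_mul]
          congr 1
          simp; ring
      _ = _ := by
          rw [sum_comm]
          simp only [← mul_sum, sum_char hχ, mul_eq_zero, h2, ha, false_or]
          simp
  rw [h1, norm_pow]
  exact_mod_cast h3

lemma gaussSum₂_of_sq_eq_neg_one (h2 : (2 : F) ≠ 0) {χ : AddChar F ℂ} (hχ : χ.IsPrimitive) {a i : F}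
    (ha : a ≠ 0) (hi : i ^ 2 = -1) : gaussSum₂ χ a = Fintype.card F := by
  have hi0 : i ≠ 0 := by rintro rfl; simp at hi
  calc gaussSum₂ χ a = ∑ y, ∑ x, χ (a * (x ^ 2 + y ^ 2)) := by
        simp only [gaussSum₂, qnorm, Fintype.sum_prod_type]
        rw [sum_comm]
    _ = ∑ y, ∑ u, χ (a * u ^ 2) * χ (y * (2 * a * i * u)) := by
        refine sum_congr rfl fun y _ => ?_
        -- In the coordinate `u = x - i * y` the form `x ^ 2 + y ^ 2` is linear in `y`.
        rw [← Equiv.sum_comp (Equiv.addRight (i * y))]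
        refine sum_congr rfl fun u _ => ?_
        rw [← AddChar.map_add_eq_mul]
        congr 1
        simp
        linear_combination a * y ^ 2 * hi
    _ = _ := by
        rw [sum_comm]
        simp only [← mul_sum, sum_char hχ, mul_eq_zero, h2, ha, hi0, false_or]
        simp

/-- A form of Parseval's identity relating distances in `E` to its Fourier energies. -/
lemma sum_distCount_sq_le (h2 : (2 : F) ≠ 0) {χ : AddChar F ℂ} (hχ : χ.IsPrimitive)
    (E : Finset (F × F)) :
    (Fintype.card F : ℝ) * ∑ d, (distCount E d : ℝ) ^ 2 ≤
      (#E : ℝ) ^ 4 + ((Fintype.card F : ℝ) * ∑ r, energy χ E r ^ 2) / (Fintype.card F : ℝ) ^ 2 := by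
  have hq : (0 : ℝ) < Fintype.card F := by exact_mod_cast Fintype.card_pos
  have hA := parseval_line hχ (fun r => (energy χ E r : ℂ))
  have hN := parseval_line hχ (fun d => (distCount E d : ℂ))
  simp only [Complex.norm_natCast, Complex.norm_real, Real.norm_eq_abs, sq_abs] at hA hN
  rw [← hA, ← hN]
  rw [← (involutive_neg_inv_four_mul h2).bijective.sum_comp, sum_div, ← add_sum_erase _ _ (mem_univ (0 : F)),
    ← add_sum_erase univ (fun a => ‖∑ r, (energy χ E r : ℂ) * χ (a * r)‖ ^ 2 / _) (mem_univ (0 : F))]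
  have h0 : ‖∑ d, (distCount E d : ℂ) * χ (-(4 * 0 : F)⁻¹ * d)‖ ^ 2 = (#E : ℝ) ^ 4 := by
    simp only [mul_zero, inv_zero, neg_zero, zero_mul, AddChar.map_zero_eq_one, mul_one]
    rw [← Nat.cast_sum, sum_distCount, Complex.norm_natCast]
    push_cast; ring
  rw [h0]
  have h1 : ∀ a ∈ univ.erase (0 : F), ‖∑ d, (distCount E d : ℂ) * χ (-(4 * a)⁻¹ * d)‖ ^ 2 =
      ‖∑ r, (energy χ E r : ℂ) * χ (a * r)‖ ^ 2 / (Fintype.card F : ℝ) ^ 2 := by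
    intro a ha
    have ha := (mem_erase.1 ha).1
    rw [sum_energy_mul_char h2 χ E ha, norm_mul, norm_gaussSum₂ h2 hχ ha]
    field_simp
  rw [sum_congr rfl h1]
  gcongr
  exact le_add_of_nonneg_left (by positivity)

/-- The energy on the degenerate circle. When `-1` is a square, the isotropic lines make both sides
large, and the bound compares the energy with the number of isotropic pairs in `E`. -/
lemma energy_zero_le (h2 : (2 : F) ≠ 0) {χ : AddChar F ℂ} (hχ : χ.IsPrimitive)
    (E : Finset (F × F)) (hE : Fintype.card F ≤ #E) :
    energy χ E 0 ≤ max ((Fintype.card F : ℝ) * distCount E 0) ((#E : ℝ) ^ 2) := by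
  have hq : (0 : ℝ) < Fintype.card F := by exact_mod_cast Fintype.card_pos
  by_cases hi : ∃ i : F, i ^ 2 = -1
  · obtain ⟨i, hi⟩ := hi
    refine le_max_of_le_left ?_
    -- Fourier inversion at `0` expresses `energy χ E 0` through `distCount E 0` exactly.
    have inv1 : ∀ H : F → ℂ, ∑ a, ∑ r, H r * χ (a * r) = Fintype.card F * H 0 := by
      intro H
      rw [sum_comm]
      simp only [← mul_sum, sum_char hχ, mul_ite, mul_zero, sum_ite_eq', mem_univ, if_true]
      ring
    have hA := inv1 (fun r => (energy χ E r : ℂ))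
    have hN := inv1 (fun d => (distCount E d : ℂ))
    rw [← (involutive_neg_inv_four_mul h2).bijective.sum_comp] at hN
    rw [← add_sum_erase _ _ (mem_univ (0 : F))] at hA hN
    have h1 : ∀ a ∈ univ.erase (0 : F), ∑ r, (energy χ E r : ℂ) * χ (a * r) =
        Fintype.card F * ∑ d, (distCount E d : ℂ) * χ (-(4 * a)⁻¹ * d) := by
      intro a ha
      have ha := (mem_erase.1 ha).1
      rw [sum_energy_mul_char h2 χ E ha, gaussSum₂_of_sq_eq_neg_one h2 hχ ha hi]
    rw [sum_congr rfl h1, ← mul_sum] at hA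
    simp only [mul_zero, inv_zero, neg_zero, zero_mul, AddChar.map_zero_eq_one, mul_one] at hA hN
    rw [← Nat.cast_sum, sum_distCount] at hN
    rw [← Complex.ofReal_sum, sum_energy hχ, eq_sub_of_add_eq' hN] at hA
    have hA' : (Fintype.card F : ℝ) ^ 2 * #E + Fintype.card F *
        (Fintype.card F * distCount E 0 - (#E : ℝ) ^ 2) = Fintype.card F * energy χ E 0 := by
      have := hA
      push_cast at this
      exact_mod_cast this
    have hE' : (Fintype.card F : ℝ) ≤ #E := by exact_mod_cast hE
    have : energy χ E 0 = (Fintype.card F : ℝ) * #E +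
        (Fintype.card F * distCount E 0 - (#E : ℝ) ^ 2) := by
      apply mul_left_cancel₀ hq.ne'
      rw [← hA']; ring
    rw [this]
    nlinarith [mul_le_mul_of_nonneg_right hE' (Nat.cast_nonneg (α := ℝ) #E)]
  · -- Only the zero vector is isotropic.
    refine le_max_of_le_right ?_
    have h0 : ∀ ξ : F × F, qnorm ξ = 0 → ξ = 0 := by
      rintro ⟨x, y⟩ h
      simp only [qnorm] at h
      have hy : y = 0 := by
        by_contra hy
        refine hi ⟨x / y, ?_⟩
        field_simp
        linear_combination h
      subst hy
      simpa using h
    have : ({ξ : F × F | qnorm ξ = 0} : Finset (F × F)) = {0} := by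
      ext ξ
      simp only [mem_filter, mem_univ, true_and, mem_singleton]
      exact ⟨h0 ξ, by rintro rfl; simp [qnorm]⟩
    rw [energy, this]
    simp [ft, dot]

end Fourier

/-! ### Restriction estimate for circles -/

section Restriction

variable {F : Type*} [Field F]

/-- A circle of nonzero radius is a Sidon set up to antipodal pairs: a nonzero vector is the sum
of at most one unordered pair of its points. -/
lemma eq_or_eq_of_add_eq_add (h2 : (2 : F) ≠ 0) {r : F} (hr : r ≠ 0) {x y z w : F × F}
    (hx : qnorm x = r) (hy : qnorm y = r) (hz : qnorm z = r) (hw : qnorm w = r)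
    (h : x + y = z + w) (hs : x + y ≠ 0) : z = x ∨ z = y := by
  obtain ⟨x1, x2⟩ := x
  obtain ⟨y1, y2⟩ := y
  obtain ⟨z1, z2⟩ := z
  obtain ⟨w1, w2⟩ := w
  simp only [qnorm, Prod.mk_add_mk, Prod.mk.injEq, ne_eq, Prod.mk_eq_zero] at *
  obtain ⟨e1, e2⟩ := h
  obtain rfl : w1 = x1 + y1 - z1 := by linear_combination -e1
  obtain rfl : w2 = x2 + y2 - z2 := by linear_combination -e2
  -- Both `z - x` and `y - x` are orthogonal to the sum `s`.
  have hz' : (x1 + y1) * (z1 - x1) + (x2 + y2) * (z2 - x2) = 0 := by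
    apply mul_left_cancel₀ h2; linear_combination hz - hw - hx + hy
  have hy' : (x1 + y1) * (y1 - x1) + (x2 + y2) * (y2 - x2) = 0 := by
    linear_combination hy - hx
  have hzy : (z1 - x1) * (z1 - y1) + (z2 - x2) * (z2 - y2) = 0 := by
    linear_combination hz - hx - hz'
  have hxs : 2 * (x1 * (x1 + y1) + x2 * (x2 + y2)) = (x1 + y1) ^ 2 + (x2 + y2) ^ 2 := by
    linear_combination hx - hy
  generalize hs1 : x1 + y1 = s1 at *
  generalize hs2 : x2 + y2 = s2 at *
  -- An isotropic `s` would be orthogonal to `x`, which would make `x` isotropic as well.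
  have hns : s1 ^ 2 + s2 ^ 2 ≠ 0 := by
    intro h0
    rw [h0] at hxs
    have hxs := (mul_eq_zero.1 hxs).resolve_left h2
    have k1 : r * s1 ^ 2 = 0 := by
      linear_combination (x2 ^ 2) * h0 - s1 ^ 2 * hx + (x1 * s1 - x2 * s2) * hxs
    have k2 : r * s2 ^ 2 = 0 := by linear_combination r * h0 - k1
    exact hs ⟨by simpa [hr] using k1, by simpa [hr] using k2⟩
  by_cases h1 : s1 = 0
  · have h3 : s2 ≠ 0 := fun h => hs ⟨h1, h⟩
    subst h1
    have a1 : z2 - x2 = 0 := by simpa [h3] using hz'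
    have a2 : y2 - x2 = 0 := by simpa [h3] using hy'
    rw [a1, zero_mul, add_zero] at hzy
    rcases mul_eq_zero.1 hzy with h | h
    · exact Or.inl ⟨sub_eq_zero.1 h, sub_eq_zero.1 a1⟩
    · exact Or.inr ⟨sub_eq_zero.1 h, by linear_combination a1 - a2⟩
  · have k : (s1 ^ 2 + s2 ^ 2) * ((z2 - x2) * (z2 - y2)) = 0 := by
      linear_combination s1 ^ 2 * hzy - s1 * (z1 - y1) * hz' +
        s2 * (z2 - x2) * hz' - s2 * (z2 - x2) * hy'
    rcases mul_eq_zero.1 ((mul_eq_zero.1 k).resolve_left hns) with h | h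
    · rw [h, mul_zero, add_zero] at hz'
      exact Or.inl ⟨sub_eq_zero.1 ((mul_eq_zero.1 hz').resolve_left h1), sub_eq_zero.1 h⟩
    · refine Or.inr ⟨?_, sub_eq_zero.1 h⟩
      apply mul_left_cancel₀ h1
      linear_combination hz' - hy' - s2 * h

variable [Fintype F] [DecidableEq F]

/-- The `L⁴` extension estimate for circles of nonzero radius: expanding the fourth power counts
additive quadruples on the circle, of which there are only trivial ones. -/
lemma sum_norm_pow_four_le (h2 : (2 : F) ≠ 0) {χ : AddChar F ℂ} (hχ : χ.IsPrimitive) {r : F}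
    (hr : r ≠ 0) (h : F × F → ℂ) :
    ∑ x, ‖∑ ξ with qnorm ξ = r, h ξ * χ (dot x ξ)‖ ^ 4 ≤
      3 * (Fintype.card F : ℝ) ^ 2 * (∑ ξ with qnorm ξ = r, ‖h ξ‖ ^ 2) ^ 2 := by
  set S : Finset (F × F) := {ξ | qnorm ξ = r} with hS
  have hmem : ∀ ξ, ξ ∈ S ↔ qnorm ξ = r := fun ξ => by simp [hS]
  set A := ∑ ξ ∈ S, ‖h ξ‖ ^ 2 with hA
  set H : F × F → ℂ := fun s => ∑ p ∈ S ×ˢ S with p.1 + p.2 = s, h p.1 * h p.2 with hH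
  have h1 : ∀ x, ‖∑ ξ ∈ S, h ξ * χ (dot x ξ)‖ ^ 4 = ‖∑ s, H s * χ (dot x s)‖ ^ 2 := by
    intro x
    have : (∑ ξ ∈ S, h ξ * χ (dot x ξ)) ^ 2 = ∑ s, H s * χ (dot x s) := by
      rw [sq, sum_mul_sum, ← sum_product',
        ← sum_fiberwise (S ×ˢ S) (fun p => p.1 + p.2)]
      refine sum_congr rfl fun s _ => ?_
      rw [hH, sum_mul]
      refine sum_congr rfl fun p hp => ?_
      rw [← (mem_filter.1 hp).2, show dot x (p.1 + p.2) = dot x p.1 + dot x p.2 by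
        simp [dot]; ring, AddChar.map_add_eq_mul]
      ring
    rw [← this, norm_pow]; ring
  rw [sum_congr rfl fun x _ => h1 x, parseval_plane hχ]
  have hprod : ∑ p ∈ S ×ˢ S, ‖h p.1 * h p.2‖ ^ 2 = A ^ 2 := by
    rw [sq, hA, sum_mul_sum, ← sum_product']
    exact sum_congr rfl fun p _ => by rw [norm_mul]; ring
  have hzero : ‖H 0‖ ^ 2 ≤ A ^ 2 := by
    refine pow_le_pow_left₀ (norm_nonneg _) ?_ 2
    have e : H 0 = ∑ ξ ∈ S, h ξ * h (-ξ) := by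
      rw [hH]
      refine sum_nbij' (fun p => p.1) (fun ξ => (ξ, -ξ)) ?_ ?_ ?_ ?_ ?_
      · intro p hp; simp only [mem_filter, mem_product] at hp; exact hp.1.1
      · intro ξ hξ
        simp only [mem_filter, mem_product, hmem] at hξ ⊢
        simpa [qnorm] using hξ
      · intro p hp
        simp only [mem_filter, mem_product] at hp
        exact Prod.ext rfl (neg_eq_of_add_eq_zero_right hp.2)
      · intro ξ _; rfl
      · intro p hp
        simp only [mem_filter, mem_product] at hp
        rw [← neg_eq_of_add_eq_zero_right hp.2]
    have eneg : ∑ ξ ∈ S, ‖h (-ξ)‖ ^ 2 = A := by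
      refine sum_nbij' (fun ξ => -ξ) (fun ξ => -ξ) ?_ ?_ ?_ ?_ ?_ <;> intro ξ hξ
      · simpa [hmem, qnorm] using hξ
      · simpa [hmem, qnorm] using hξ
      · simp
      · simp
      · rfl
    rw [e]
    calc ‖∑ ξ ∈ S, h ξ * h (-ξ)‖ ≤ ∑ ξ ∈ S, ‖h ξ * h (-ξ)‖ := norm_sum_le _ _
      _ ≤ ∑ ξ ∈ S, (‖h ξ‖ ^ 2 + ‖h (-ξ)‖ ^ 2) / 2 := by
        refine sum_le_sum fun ξ _ => ?_
        rw [norm_mul]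
        nlinarith [sq_nonneg (‖h ξ‖ - ‖h (-ξ)‖)]
      _ = A := by rw [← sum_div, sum_add_distrib, eneg]; ring
  have hne : ∀ s ≠ 0, ‖H s‖ ^ 2 ≤ 2 * ∑ p ∈ S ×ˢ S with p.1 + p.2 = s, ‖h p.1 * h p.2‖ ^ 2 := by
    intro s hs
    have hc : #{p ∈ S ×ˢ S | p.1 + p.2 = s} ≤ 2 := by
      rcases ({p ∈ S ×ˢ S | p.1 + p.2 = s} : Finset _).eq_empty_or_nonempty with h0 | ⟨⟨x, y⟩, hp⟩
      · simp [h0]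
      refine (card_le_card (t := {(x, y), (y, x)}) ?_).trans card_le_two
      rintro ⟨z, w⟩ hz
      simp only [mem_filter, mem_product, hmem] at hp hz
      have hxy := hp.2
      subst hxy
      rcases eq_or_eq_of_add_eq_add h2 hr hp.1.1 hp.1.2 hz.1.1 hz.1.2 hz.2.symm hs with rfl | rfl
      · simp [add_left_cancel hz.2]
      · have := hz.2
        rw [add_comm x, add_right_inj] at this
        simp [this]
    calc ‖H s‖ ^ 2 ≤ (∑ p ∈ S ×ˢ S with p.1 + p.2 = s, ‖h p.1 * h p.2‖) ^ 2 :=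
          pow_le_pow_left₀ (norm_nonneg _) (norm_sum_le _ _) 2
      _ ≤ _ := sq_sum_le_card_mul_sum_sq
      _ ≤ _ := by
        gcongr
        exact_mod_cast hc
  have hsum : ∑ s, ‖H s‖ ^ 2 ≤ 3 * A ^ 2 := by
    rw [← add_sum_erase _ _ (mem_univ (0 : F × F))]
    have : ∑ s ∈ univ.erase 0, ‖H s‖ ^ 2 ≤ 2 * A ^ 2 := by
      calc _ ≤ ∑ s ∈ univ.erase 0,
            2 * ∑ p ∈ S ×ˢ S with p.1 + p.2 = s, ‖h p.1 * h p.2‖ ^ 2 :=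
            sum_le_sum fun s hs => hne s (mem_erase.1 hs).1
        _ ≤ ∑ s, 2 * ∑ p ∈ S ×ˢ S with p.1 + p.2 = s, ‖h p.1 * h p.2‖ ^ 2 :=
            sum_le_sum_of_subset_of_nonneg (erase_subset _ _) fun _ _ _ => by positivity
        _ = 2 * A ^ 2 := by rw [← mul_sum, sum_fiberwise, hprod]
    linarith
  nlinarith [mul_le_mul_of_nonneg_left hsum (by positivity : (0 : ℝ) ≤ (Fintype.card F : ℝ) ^ 2)]

/-- The restriction estimate for circles of nonzero radius, obtained by duality from the `L⁴` bound
for the extension operator. -/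
lemma energy_sq_le (h2 : (2 : F) ≠ 0) {χ : AddChar F ℂ} (hχ : χ.IsPrimitive) (E : Finset (F × F))
    {r : F} (hr : r ≠ 0) :
    energy χ E r ^ 2 ≤ 3 * (Fintype.card F : ℝ) ^ 2 * (#E : ℝ) ^ 3 := by
  set A := energy χ E r with hA
  have hA0 : 0 ≤ A := energy_nonneg χ E r
  set G : F × F → ℂ := fun x => ∑ ξ with qnorm ξ = r, conj (ft χ E ξ) * χ (dot x ξ) with hG
  have h4 : ∑ x, ‖G x‖ ^ 4 ≤ 3 * (Fintype.card F : ℝ) ^ 2 * A ^ 2 := by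
    have := sum_norm_pow_four_le h2 hχ hr fun ξ => conj (ft χ E ξ)
    simp only [RCLike.norm_conj] at this
    exact this
  have h1 : (A : ℂ) = ∑ x ∈ E, G x := by
    rw [hG, sum_comm, hA, energy, Complex.ofReal_sum]
    refine sum_congr rfl fun ξ _ => ?_
    rw [← mul_sum, Complex.ofReal_pow, ← Complex.conj_mul', ft]
    congr 1
    exact sum_congr rfl fun x _ => by simp [dot, mul_comm]
  have h2' : A ≤ ∑ x ∈ E, ‖G x‖ := by
    have := norm_sum_le E G
    rwa [← h1, Complex.norm_real, Real.norm_of_nonneg hA0] at this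
  have h3 : A ^ 2 ≤ #E * ∑ x ∈ E, ‖G x‖ ^ 2 :=
    (pow_le_pow_left₀ hA0 h2' 2).trans sq_sum_le_card_mul_sum_sq
  have h5 : (∑ x ∈ E, ‖G x‖ ^ 2) ^ 2 ≤ #E * ∑ x, ‖G x‖ ^ 4 := by
    refine sq_sum_le_card_mul_sum_sq.trans ?_
    simp only [← pow_mul]
    gcongr
    exact subset_univ E
  have h6 : A ^ 2 * A ^ 2 ≤ (3 * (Fintype.card F : ℝ) ^ 2 * (#E : ℝ) ^ 3) * A ^ 2 := by
    calc A ^ 2 * A ^ 2 ≤ (#E * ∑ x ∈ E, ‖G x‖ ^ 2) * (#E * ∑ x ∈ E, ‖G x‖ ^ 2) := by gcongr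
      _ = (#E : ℝ) ^ 2 * (∑ x ∈ E, ‖G x‖ ^ 2) ^ 2 := by ring
      _ ≤ (#E : ℝ) ^ 2 * (#E * (3 * (Fintype.card F : ℝ) ^ 2 * A ^ 2)) := by
        gcongr; exact h5.trans (by gcongr)
      _ = _ := by ring
  rcases hA0.eq_or_lt with h0 | h0
  · rw [← h0, zero_pow two_ne_zero]; positivity
  · exact le_of_mul_le_mul_right h6 (by positivity)

/-- The number of pairs of pairs of points of `E` with equal nonzero distances. -/
lemma sum_distCount_sq_ne_zero_le (h2 : (2 : F) ≠ 0) (E : Finset (F × F))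
    (hE : Fintype.card F ≤ #E) :
    ∑ d ∈ univ.erase 0, (distCount E d : ℝ) ^ 2 ≤
      2 * (#E : ℝ) ^ 4 / Fintype.card F + 2 * Fintype.card F * #E * √((#E : ℝ) ^ 3) := by
  obtain ⟨χ, hχ⟩ : ∃ χ : AddChar F ℂ, χ.IsPrimitive :=
    ⟨_, AddChar.FiniteField.primitiveChar_to_Complex_isPrimitive F⟩
  have hq : (1 : ℝ) ≤ Fintype.card F := by exact_mod_cast Fintype.card_pos (α := F)
  have hE0 : (0 : ℝ) ≤ #E := Nat.cast_nonneg _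
  have hpars := sum_distCount_sq_le h2 hχ E
  have h0 := energy_zero_le h2 hχ E hE
  have hsum := sum_energy hχ E
  have hmax : ∀ r ∈ univ.erase (0 : F), energy χ E r ≤ 2 * Fintype.card F * √((#E : ℝ) ^ 3) := by
    intro r hr
    refine (pow_le_pow_iff_left₀ (energy_nonneg _ _ _) (by positivity) two_ne_zero).1 ?_
    rw [mul_pow, Real.sq_sqrt (by positivity)]
    refine (energy_sq_le h2 hχ E (mem_erase.1 hr).1).trans ?_
    rw [mul_pow]
    gcongr
    norm_num
  have hr : ∑ r ∈ univ.erase 0, energy χ E r ^ 2 ≤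
      2 * Fintype.card F * √((#E : ℝ) ^ 3) * ((Fintype.card F : ℝ) ^ 2 * #E) := by
    rw [← hsum, mul_sum]
    calc _ ≤ ∑ r ∈ univ.erase 0, 2 * Fintype.card F * √((#E : ℝ) ^ 3) * energy χ E r := by
          refine sum_le_sum fun r hr => ?_
          rw [sq]
          exact mul_le_mul_of_nonneg_right (hmax r hr) (energy_nonneg _ _ _)
      _ ≤ _ := sum_le_sum_of_subset_of_nonneg (erase_subset _ _) fun r _ _ =>
          mul_nonneg (by positivity) (energy_nonneg _ _ _)
  have h0' : energy χ E 0 ^ 2 ≤ ((Fintype.card F : ℝ) * distCount E 0) ^ 2 + (#E : ℝ) ^ 4 := by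
    rcases le_max_iff.1 h0 with h | h
    · have := pow_le_pow_left₀ (energy_nonneg χ E 0) h 2
      linarith [pow_nonneg hE0 4]
    · have := pow_le_pow_left₀ (energy_nonneg χ E 0) h 2
      nlinarith [sq_nonneg ((Fintype.card F : ℝ) * distCount E 0)]
  rw [← add_sum_erase _ _ (mem_univ (0 : F)), ← add_sum_erase _ _ (mem_univ (0 : F))] at hpars
  set X := ∑ d ∈ univ.erase (0 : F), (distCount E d : ℝ) ^ 2
  set Y := ∑ r ∈ univ.erase (0 : F), energy χ E r ^ 2
  set q : ℝ := (Fintype.card F : ℝ)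
  set N : ℝ := (#E : ℝ)
  have hq0 : 0 < q := by linarith
  have e1 : q * (energy χ E 0 ^ 2 + Y) / q ^ 2 = (energy χ E 0 ^ 2 + Y) / q := by field_simp
  rw [e1] at hpars
  have e2 : (energy χ E 0 ^ 2 + Y) / q ≤
      ((q * distCount E 0) ^ 2 + N ^ 4 + 2 * q * √(N ^ 3) * (q ^ 2 * N)) / q := by
    gcongr ?_ / q; linarith
  have e3 : ((q * distCount E 0) ^ 2 + N ^ 4 + 2 * q * √(N ^ 3) * (q ^ 2 * N)) / q =
      q * (distCount E 0 : ℝ) ^ 2 + N ^ 4 / q + q * (2 * q * N * √(N ^ 3)) := by field_simp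
  have e4 : N ^ 4 / q ≤ N ^ 4 := div_le_self (by positivity) hq
  have e5 : q * X ≤ q * (2 * N ^ 4 / q + 2 * q * N * √(N ^ 3)) := by
    have : q * (2 * N ^ 4 / q + 2 * q * N * √(N ^ 3)) = 2 * N ^ 4 + q * (2 * q * N * √(N ^ 3)) := by
      field_simp
    rw [this]; linarith
  exact le_of_mul_le_mul_left e5 hq0

end Restriction

/-! ### Isosceles triangles, zero distances and the deletion method -/

lemma card_filter_eq_eq_sum_sq {α β : Type*} [Fintype β] [DecidableEq β] (s : Finset α)
    (f : α → β) : #{p ∈ s ×ˢ s | f p.1 = f p.2} = ∑ b, #{a ∈ s | f a = b} ^ 2 := by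
  rw [card_eq_sum_card_fiberwise (f := fun p => f p.1) (t := univ) fun _ _ => mem_coe.2 (mem_univ _)]
  refine sum_congr rfl fun b _ => ?_
  rw [sq, ← card_product]
  congr 1
  ext p
  simp only [mem_filter, mem_product]
  constructor
  · rintro ⟨⟨⟨h1, h2⟩, h3⟩, h4⟩; exact ⟨⟨h1, h4⟩, h2, h3 ▸ h4⟩
  · rintro ⟨⟨h1, h4⟩, h2, h3⟩; exact ⟨⟨⟨h1, h2⟩, h4.trans h3.symm⟩, h4⟩

section Counting

variable {F : Type*} [Field F] [Fintype F] [DecidableEq F]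

/-- The number of points of `E` at distance `d` from `x`. -/
def pinCount (E : Finset (F × F)) (x : F × F) (d : F) : ℕ := #{y ∈ E | qnorm (x - y) = d}

lemma sum_pinCount (E : Finset (F × F)) (x : F × F) : ∑ d, pinCount E x d = #E :=
  (card_eq_sum_card_fiberwise (fun _ _ => mem_coe.2 (mem_univ _))).symm

lemma card_bisector_le (h2 : (2 : F) ≠ 0) {y z : F × F} (hyz : y ≠ z) :
    #{x : F × F | qnorm (x - y) = qnorm (x - z)} ≤ Fintype.card F := by
  by_cases h1 : y.1 = z.1
  · have h3 : z.2 - y.2 ≠ 0 := fun h => hyz (Prod.ext h1 (sub_eq_zero.1 h).symm)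
    refine card_le_card_of_injOn Prod.fst (fun _ _ => mem_coe.2 (mem_univ _)) ?_
    rintro ⟨a, b⟩ hx ⟨a', b'⟩ hx' h
    replace hx := (mem_filter.1 (mem_coe.1 hx)).2
    replace hx' := (mem_filter.1 (mem_coe.1 hx')).2
    simp only [qnorm, Prod.fst_sub, Prod.snd_sub] at hx hx' h
    subst h
    refine Prod.ext rfl ?_
    apply mul_left_cancel₀ (mul_ne_zero h2 h3)
    linear_combination hx - hx'
  · have h3 : z.1 - y.1 ≠ 0 := fun h => h1 (sub_eq_zero.1 h).symm
    refine card_le_card_of_injOn Prod.snd (fun _ _ => mem_coe.2 (mem_univ _)) ?_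
    rintro ⟨a, b⟩ hx ⟨a', b'⟩ hx' h
    replace hx := (mem_filter.1 (mem_coe.1 hx)).2
    replace hx' := (mem_filter.1 (mem_coe.1 hx')).2
    simp only [qnorm, Prod.fst_sub, Prod.snd_sub] at hx hx' h
    subst h
    refine Prod.ext ?_ rfl
    apply mul_left_cancel₀ (mul_ne_zero h2 h3)
    linear_combination hx - hx'

lemma sum_sum_pinCount_sq_le (h2 : (2 : F) ≠ 0) (E : Finset (F × F)) :
    ∑ x, ∑ d, pinCount E x d ^ 2 ≤
      #E * Fintype.card F ^ 2 + #E ^ 2 * Fintype.card F := by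
  calc ∑ x, ∑ d, pinCount E x d ^ 2
      = ∑ x, #{p ∈ E ×ˢ E | qnorm (x - p.1) = qnorm (x - p.2)} :=
        sum_congr rfl fun x _ => (card_filter_eq_eq_sum_sq E fun y => qnorm (x - y)).symm
    _ = ∑ p ∈ E ×ˢ E, #{x : F × F | qnorm (x - p.1) = qnorm (x - p.2)} := by
        simp only [card_filter]
        rw [sum_comm]
    _ = ∑ p ∈ E.diag, #{x : F × F | qnorm (x - p.1) = qnorm (x - p.2)} +
          ∑ p ∈ E.offDiag, #{x : F × F | qnorm (x - p.1) = qnorm (x - p.2)} := by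
        rw [← diag_union_offDiag, sum_union (disjoint_diag_offDiag E)]
    _ ≤ #E.diag • Fintype.card F ^ 2 + #E.offDiag • Fintype.card F := by
        refine add_le_add (sum_le_card_nsmul _ _ _ fun p _ => ?_)
          (sum_le_card_nsmul _ _ _ fun p hp => card_bisector_le h2 (mem_offDiag.1 hp).2.2)
        refine (card_le_univ _).trans ?_
        rw [Fintype.card_prod, sq]
    _ ≤ _ := by
        rw [diag_card, offDiag_card, smul_eq_mul, smul_eq_mul, sq #E]
        gcongr
        exact Nat.sub_le _ _

/-- The number of isosceles triangles in `E`, degenerate ones included. The deviations of the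
pinned counts `pinCount E x d` from their mean `#E / q` have a small second moment when `x` ranges
over the whole plane, and restricting `x` to `E` only decreases this moment. -/
lemma sum_pinCount_sq_le (h2 : (2 : F) ≠ 0) (E : Finset (F × F)) :
    ∑ x ∈ E, ∑ d, (pinCount E x d : ℝ) ^ 2 ≤
      2 * (#E : ℝ) ^ 3 / Fintype.card F + 2 * #E * (Fintype.card F : ℝ) ^ 2 := by
  have hq : (0 : ℝ) < Fintype.card F := by exact_mod_cast Fintype.card_pos (α := F)
  have htot : ∑ x, ∑ d, (pinCount E x d : ℝ) ^ 2 ≤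
      #E * (Fintype.card F : ℝ) ^ 2 + (#E : ℝ) ^ 2 * Fintype.card F := by
    exact_mod_cast sum_sum_pinCount_sq_le h2 E
  have hpin : ∀ x, ∑ d, (pinCount E x d : ℝ) = #E := fun x => by exact_mod_cast sum_pinCount E x
  set q : ℝ := (Fintype.card F : ℝ) with hqdef
  set N : ℝ := (#E : ℝ) with hN
  have hone : ∀ x, ∑ d, ((pinCount E x d : ℝ) - N / q) ^ 2 =
      ∑ d, (pinCount E x d : ℝ) ^ 2 - N ^ 2 / q := by
    intro x
    simp only [sub_sq, sum_add_distrib, sum_sub_distrib, ← sum_mul, ← mul_sum, hpin]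
    rw [sum_const, card_univ, nsmul_eq_mul, ← hqdef]
    field_simp
    ring
  have hvar : ∑ x, ∑ d, ((pinCount E x d : ℝ) - N / q) ^ 2 ≤ N * q ^ 2 := by
    simp only [hone, sum_sub_distrib]
    rw [sum_const, card_univ, nsmul_eq_mul, Fintype.card_prod, Nat.cast_mul, ← hqdef]
    have : q * q * (N ^ 2 / q) = N ^ 2 * q := by field_simp
    linarith
  calc ∑ x ∈ E, ∑ d, (pinCount E x d : ℝ) ^ 2
      = ∑ x ∈ E, (∑ d, ((pinCount E x d : ℝ) - N / q) ^ 2 + N ^ 2 / q) :=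
        sum_congr rfl fun x _ => by rw [hone]; ring
    _ = ∑ x ∈ E, ∑ d, ((pinCount E x d : ℝ) - N / q) ^ 2 + N ^ 3 / q := by
        rw [sum_add_distrib, sum_const, nsmul_eq_mul]; ring
    _ ≤ N * q ^ 2 + N ^ 3 / q := by
        gcongr
        exact (sum_le_sum_of_subset_of_nonneg (subset_univ E) fun _ _ _ =>
          sum_nonneg fun _ _ => sq_nonneg _).trans hvar
    _ ≤ _ := by
        have e1 : 0 ≤ N * q ^ 2 := by positivity
        have e2 : 0 ≤ N ^ 3 / q := by positivity
        rw [mul_div_assoc]; linarith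

lemma card_qnorm_eq_zero_le : #{v : F × F | qnorm v = 0} ≤ 2 * Fintype.card F := by
  refine (card_le_mul_card_image (f := Prod.fst) _ 2 ?_).trans
    (Nat.mul_le_mul_left 2 (card_le_univ _))
  intro a ha
  obtain ⟨⟨a, b⟩, hab, rfl⟩ := mem_image.1 ha
  refine (card_le_card (t := {(a, b), (a, -b)}) ?_).trans card_le_two
  rintro ⟨a', b'⟩ h
  simp only [mem_filter, mem_univ, true_and] at h hab
  obtain ⟨h, rfl⟩ := h
  simp only [qnorm] at h hab
  have : b' ^ 2 = b ^ 2 := by linear_combination h - hab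
  rcases sq_eq_sq_iff_eq_or_eq_neg.1 this with rfl | rfl <;> simp

lemma distCount_zero_le (E : Finset (F × F)) : distCount E 0 ≤ 2 * Fintype.card F * #E := by
  rw [distCount, card_filter, sum_product]
  have : ∀ x ∈ E, (∑ y ∈ E, if qnorm (x - y) = 0 then 1 else 0) ≤ 2 * Fintype.card F := by
    intro x _
    rw [← card_filter]
    refine le_trans ?_ (card_qnorm_eq_zero_le (F := F))
    exact card_le_card_of_injOn (fun y => x - y) (fun y hy => by simpa using (mem_filter.1 hy).2)
      (fun y _ z _ h => sub_right_injective h)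
  refine (sum_le_card_nsmul _ _ _ this).trans_eq ?_
  rw [smul_eq_mul, mul_comm]

end Counting

section Deletion

variable {α : Type*}

/-- The weight of `U` under the random subset of `V` that keeps each point with probability `p`. -/
def bernoulliWeight (V : Finset α) (p : ℝ) (U : Finset α) : ℝ := p ^ #U * (1 - p) ^ (#V - #U)

lemma sum_bernoulliWeight (V : Finset α) (p : ℝ) :
    ∑ U ∈ V.powerset, bernoulliWeight V p U = 1 := by
  simp only [bernoulliWeight]
  rw [sum_pow_mul_eq_add_pow]; simp

variable [DecidableEq α]

lemma sum_bernoulliWeight_superset {V e : Finset α} (he : e ⊆ V) (p : ℝ) :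
    ∑ U ∈ V.powerset with e ⊆ U, bernoulliWeight V p U = p ^ #e := by
  have h : ∑ U ∈ V.powerset with e ⊆ U, bernoulliWeight V p U =
      ∑ W ∈ (V \ e).powerset, p ^ #e * bernoulliWeight (V \ e) p W := by
    refine sum_nbij' (fun U => U \ e) (fun W => e ∪ W) ?_ ?_ ?_ ?_ ?_
    · intro U hU
      simp only [mem_filter, mem_powerset] at hU ⊢
      exact sdiff_subset_sdiff hU.1 subset_rfl
    · intro W hW
      simp only [mem_filter, mem_powerset] at hW ⊢
      exact ⟨union_subset he (hW.trans sdiff_subset), subset_union_left⟩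
    · intro U hU
      exact union_sdiff_of_subset (mem_filter.1 hU).2
    · intro W hW
      have : Disjoint e W := (disjoint_sdiff (s := e) (t := V)).mono_right (mem_powerset.1 hW)
      rw [union_sdiff_cancel_left this]
    · intro U hU
      have h1 := (mem_filter.1 hU).2
      have h3 := card_le_card h1
      rw [bernoulliWeight, bernoulliWeight, card_sdiff_of_subset he, card_sdiff_of_subset h1,
        ← mul_assoc, ← pow_add, Nat.add_sub_cancel' h3]
      congr 2
      omega
  rw [h, ← mul_sum, sum_bernoulliWeight, mul_one]

/-- The deletion method: a random subset of density `p` contains few members of `H`, and removing a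
point from each of them leaves a large subset containing none. -/
lemma exists_subset_avoiding (V : Finset α) (H : Finset (Finset α)) (hne : ∀ e ∈ H, e.Nonempty)
    {p : ℝ} (hp0 : 0 ≤ p) (hp1 : p ≤ 1) :
    ∃ U ⊆ V, (∀ e ∈ H, ¬ e ⊆ U) ∧ p * #V - ∑ e ∈ H, p ^ #e ≤ #U := by
  have hw : ∀ U, 0 ≤ bernoulliWeight V p U := fun U =>
    mul_nonneg (pow_nonneg hp0 _) (pow_nonneg (sub_nonneg.2 hp1) _)
  let X : Finset α → ℝ := fun U => #U - #{e ∈ H | e ⊆ U}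
  obtain ⟨U, hU, hmax⟩ := exists_max_image V.powerset X ⟨∅, empty_mem_powerset V⟩
  have hcard : ∑ U ∈ V.powerset, bernoulliWeight V p U * #U = p * #V := by
    calc ∑ U ∈ V.powerset, bernoulliWeight V p U * #U
        = ∑ U ∈ V.powerset, ∑ v ∈ V, if v ∈ U then bernoulliWeight V p U else 0 := by
          refine sum_congr rfl fun U hU => ?_
          rw [← sum_filter, sum_const, nsmul_eq_mul, mul_comm, filter_mem_eq_inter,
            inter_eq_right.2 (mem_powerset.1 hU)]
      _ = ∑ v ∈ V, p := by
          rw [sum_comm]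
          refine sum_congr rfl fun v hv => ?_
          have := sum_bernoulliWeight_superset (singleton_subset_iff.2 hv) p
          simpa [← sum_filter] using this
      _ = _ := by rw [sum_const, nsmul_eq_mul, mul_comm]
  have hbad : ∑ U ∈ V.powerset, bernoulliWeight V p U * #{e ∈ H | e ⊆ U} ≤ ∑ e ∈ H, p ^ #e := by
    calc ∑ U ∈ V.powerset, bernoulliWeight V p U * #{e ∈ H | e ⊆ U}
        = ∑ U ∈ V.powerset, ∑ e ∈ H, if e ⊆ U then bernoulliWeight V p U else 0 := by
          refine sum_congr rfl fun U hU => ?_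
          rw [← sum_filter, sum_const, nsmul_eq_mul, mul_comm]
      _ = ∑ e ∈ H, ∑ U ∈ V.powerset with e ⊆ U, bernoulliWeight V p U := by
          rw [sum_comm]
          exact sum_congr rfl fun v hv => (sum_filter _ _).symm
      _ ≤ _ := by
          refine sum_le_sum fun e _ => ?_
          by_cases he : e ⊆ V
          · exact (sum_bernoulliWeight_superset he p).le
          · rw [filter_false_of_mem fun U hU h => he (h.trans (mem_powerset.1 hU)), sum_empty]
            positivity
  have hX : p * #V - ∑ e ∈ H, p ^ #e ≤ X U := by
    calc p * #V - ∑ e ∈ H, p ^ #e ≤ ∑ W ∈ V.powerset, bernoulliWeight V p W * X W := by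
          simp only [X, mul_sub, sum_sub_distrib]
          linarith
      _ ≤ ∑ W ∈ V.powerset, bernoulliWeight V p W * X U :=
          sum_le_sum fun W hW => mul_le_mul_of_nonneg_left (hmax W hW) (hw W)
      _ = X U := by rw [← sum_mul, sum_bernoulliWeight, one_mul]
  rcases H.eq_empty_or_nonempty with rfl | ⟨e₀, he₀⟩
  · exact ⟨U, mem_powerset.1 hU, by simp, by simpa [X] using hX⟩
  have : Nonempty α := ⟨(hne e₀ he₀).choose⟩
  choose! v hv using hne
  refine ⟨U \ image v {e ∈ H | e ⊆ U}, sdiff_subset.trans (mem_powerset.1 hU), ?_, hX.trans ?_⟩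
  · intro e he hsub
    have h1 := hsub (hv e he)
    rw [mem_sdiff] at h1
    exact h1.2 (mem_image_of_mem _ (mem_filter.2 ⟨he, hsub.trans sdiff_subset⟩))
  · have h1 := le_card_sdiff (image v {e ∈ H | e ⊆ U}) U
    have h3 : #(image v {e ∈ H | e ⊆ U}) ≤ #{e ∈ H | e ⊆ U} := card_image_le
    have h4 : #U ≤ #(U \ image v {e ∈ H | e ⊆ U}) + #{e ∈ H | e ⊆ U} := by omega
    have h5 : (#U : ℝ) ≤ #(U \ image v {e ∈ H | e ⊆ U}) + #{e ∈ H | e ⊆ U} := by exact_mod_cast h4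
    simp only [X]
    linarith

lemma sum_pow_card_image_le {β : Type*} (S : Finset β) (f : β → Finset α) (k : ℕ)
    (hf : ∀ b ∈ S, #(f b) = k) {p : ℝ} (hp : 0 ≤ p) :
    ∑ e ∈ image f S, p ^ #e ≤ #S * p ^ k := by
  calc ∑ e ∈ image f S, p ^ #e = ∑ e ∈ image f S, p ^ k := by
        refine sum_congr rfl fun e he => ?_
        obtain ⟨b, hb, rfl⟩ := mem_image.1 he
        rw [hf b hb]
    _ = #(image f S) * p ^ k := by rw [sum_const, nsmul_eq_mul]
    _ ≤ _ := by
        gcongr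
        exact card_image_le

end Deletion

/-! ### Construction of distinct distance sets -/

section Assembly

variable {F : Type*} [Field F] [Fintype F] [DecidableEq F]

/-- Deletion applied to the three kinds of coincidence: pairs at distance zero, isosceles triangles,
and disjoint pairs at the same nonzero distance. -/
lemma exists_subset_distinct (E : Finset (F × F)) {p : ℝ} (hp0 : 0 ≤ p) (hp1 : p ≤ 1) :
    ∃ U ⊆ E,
      (∀ x ∈ U, ∀ y ∈ U, ∀ z ∈ U, ∀ t ∈ U, x ≠ y → z ≠ t → qnorm (x - y) = qnorm (z - t) →
        (x = z ∧ y = t) ∨ (x = t ∧ y = z)) ∧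
      p * #E - (distCount E 0 * p ^ 2 + (∑ x ∈ E, ∑ d, (pinCount E x d : ℝ) ^ 2) * p ^ 3 +
        (∑ d ∈ univ.erase 0, (distCount E d : ℝ) ^ 2) * p ^ 4) ≤ #U := by
  let S2 : Finset ((F × F) × (F × F)) := {a ∈ E ×ˢ E | qnorm (a.1 - a.2) = 0 ∧ a.1 ≠ a.2}
  let S3 : Finset ((F × F) × ((F × F) × (F × F))) := {a ∈ E ×ˢ (E ×ˢ E) |
    qnorm (a.1 - a.2.1) = qnorm (a.1 - a.2.2) ∧ a.1 ≠ a.2.1 ∧ a.1 ≠ a.2.2 ∧ a.2.1 ≠ a.2.2}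
  let S4 : Finset (((F × F) × (F × F)) × ((F × F) × (F × F))) :=
    {a ∈ (E ×ˢ E) ×ˢ (E ×ˢ E) | qnorm (a.1.1 - a.1.2) = qnorm (a.2.1 - a.2.2) ∧
      qnorm (a.1.1 - a.1.2) ≠ 0 ∧ a.1.1 ≠ a.1.2 ∧ a.1.1 ≠ a.2.1 ∧ a.1.1 ≠ a.2.2 ∧
      a.1.2 ≠ a.2.1 ∧ a.1.2 ≠ a.2.2 ∧ a.2.1 ≠ a.2.2}
  let f2 : (F × F) × (F × F) → Finset (F × F) := fun a => {a.1, a.2}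
  let f3 : (F × F) × ((F × F) × (F × F)) → Finset (F × F) := fun a => {a.1, a.2.1, a.2.2}
  let f4 : ((F × F) × (F × F)) × ((F × F) × (F × F)) → Finset (F × F) :=
    fun a => {a.1.1, a.1.2, a.2.1, a.2.2}
  have hc2 : #S2 ≤ distCount E 0 :=
    card_le_card fun a ha => mem_filter.2 ⟨(mem_filter.1 ha).1, (mem_filter.1 ha).2.1⟩
  have hc3 : #S3 ≤ ∑ x ∈ E, ∑ d, pinCount E x d ^ 2 := by
    calc #S3 ≤ #{a ∈ E ×ˢ (E ×ˢ E) | qnorm (a.1 - a.2.1) = qnorm (a.1 - a.2.2)} :=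
          card_le_card fun a ha => mem_filter.2 ⟨(mem_filter.1 ha).1, (mem_filter.1 ha).2.1⟩
      _ = ∑ x ∈ E, #{p ∈ E ×ˢ E | qnorm (x - p.1) = qnorm (x - p.2)} := by
          simp only [card_filter]
          rw [sum_product]
      _ = _ := sum_congr rfl fun x _ => card_filter_eq_eq_sum_sq E fun y => qnorm (x - y)
  have hc4 : #S4 ≤ ∑ d ∈ univ.erase 0, distCount E d ^ 2 := by
    let D : Finset ((F × F) × (F × F)) := {a ∈ E ×ˢ E | qnorm (a.1 - a.2) ≠ 0}
    calc #S4 ≤ #{a ∈ D ×ˢ D | qnorm (a.1.1 - a.1.2) = qnorm (a.2.1 - a.2.2)} := by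
          refine card_le_card fun a ha => ?_
          simp only [S4, D, mem_filter, mem_product] at ha ⊢
          exact ⟨⟨⟨ha.1.1, ha.2.2.1⟩, ha.1.2, ha.2.1 ▸ ha.2.2.1⟩, ha.2.1⟩
      _ = ∑ d, #{a ∈ D | qnorm (a.1 - a.2) = d} ^ 2 :=
          card_filter_eq_eq_sum_sq D fun a => qnorm (a.1 - a.2)
      _ = ∑ d ∈ univ.erase 0, #{a ∈ D | qnorm (a.1 - a.2) = d} ^ 2 := by
          rw [← add_sum_erase _ _ (mem_univ (0 : F)),
            filter_false_of_mem fun a ha => (mem_filter.1 ha).2]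
          simp
      _ ≤ _ := by
          refine sum_le_sum fun d _ => Nat.pow_le_pow_left (card_le_card ?_) 2
          exact filter_subset_filter _ (filter_subset _ _)
  have hk2 : ∀ a ∈ S2, #(f2 a) = 2 := fun a ha => card_pair (mem_filter.1 ha).2.2
  have hk3 : ∀ a ∈ S3, #(f3 a) = 3 := fun a ha =>
    card_eq_three.2 ⟨_, _, _, (mem_filter.1 ha).2.2.1, (mem_filter.1 ha).2.2.2.1,
      (mem_filter.1 ha).2.2.2.2, rfl⟩
  have hk4 : ∀ a ∈ S4, #(f4 a) = 4 := by
    intro a ha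
    obtain ⟨-, -, h1, h2, h3, h4, h5, h6⟩ := (mem_filter.1 ha).2
    simp [f4, h1, h2, h3, h4, h5, h6]
  obtain ⟨U, hUE, hU, hcard⟩ := exists_subset_avoiding E
    (image f2 S2 ∪ (image f3 S3 ∪ image f4 S4)) (by
      intro e he
      simp only [mem_union, mem_image] at he
      rcases he with ⟨a, -, rfl⟩ | ⟨a, -, rfl⟩ | ⟨a, -, rfl⟩ <;> exact insert_nonempty _ _) hp0 hp1
  refine ⟨U, hUE, ?_, ?_⟩
  · intro x hx y hy z hz t ht hxy hzt h
    have hn2 : ∀ x ∈ U, ∀ y ∈ U, x ≠ y → qnorm (x - y) ≠ 0 := fun x hx y hy hxy h0 =>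
      hU (f2 (x, y)) (mem_union_left _ (mem_image_of_mem _ (mem_filter.2
        ⟨mem_product.2 ⟨hUE hx, hUE hy⟩, h0, hxy⟩))) (by simp [f2, insert_subset_iff, hx, hy])
    have hn3 : ∀ x ∈ U, ∀ y ∈ U, ∀ z ∈ U, x ≠ y → x ≠ z → qnorm (x - y) = qnorm (x - z) →
        y = z := by
      intro x hx y hy z hz hxy hxz h0
      by_contra hyz
      exact hU (f3 (x, y, z)) (mem_union_right _ (mem_union_left _ (mem_image_of_mem _
        (mem_filter.2 ⟨mem_product.2 ⟨hUE hx, mem_product.2 ⟨hUE hy, hUE hz⟩⟩, h0, hxy, hxz,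
          hyz⟩)))) (by simp [f3, insert_subset_iff, hx, hy, hz])
    have hsymm : ∀ x y : F × F, qnorm (x - y) = qnorm (y - x) := fun x y => by
      simp only [qnorm, Prod.fst_sub, Prod.snd_sub]; ring
    by_cases h1 : x = z
    · subst h1
      exact Or.inl ⟨rfl, hn3 x hx y hy t ht hxy hzt h⟩
    by_cases h3 : x = t
    · subst h3
      exact Or.inr ⟨rfl, hn3 x hx y hy z hz hxy hzt.symm (h.trans (hsymm _ _))⟩
    by_cases h4 : y = z
    · subst h4
      exact absurd (hn3 y hy x hx t ht hxy.symm hzt ((hsymm _ _).trans h)) h3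
    by_cases h5 : y = t
    · subst h5
      exact absurd (hn3 y hy x hx z hz hxy.symm hzt.symm
        ((hsymm _ _).trans (h.trans (hsymm _ _)))) h1
    refine absurd ?_ (hU (f4 ((x, y), (z, t))) (mem_union_right _ (mem_union_right _
      (mem_image_of_mem _ (mem_filter.2 ⟨mem_product.2 ⟨mem_product.2 ⟨hUE hx, hUE hy⟩,
        mem_product.2 ⟨hUE hz, hUE ht⟩⟩, h, hn2 x hx y hy hxy, hxy, h1, h3, h4, h5, hzt⟩)))))
    simp [f4, insert_subset_iff, hx, hy, hz, ht]
  · refine le_trans (sub_le_sub_left ?_ _) hcard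
    have hunion : ∀ A B : Finset (Finset (F × F)),
        ∑ e ∈ A ∪ B, p ^ #e ≤ ∑ e ∈ A, p ^ #e + ∑ e ∈ B, p ^ #e := fun A B => by
      rw [← sum_union_inter]
      exact le_add_of_nonneg_right (sum_nonneg fun _ _ => by positivity)
    have h2 := sum_pow_card_image_le S2 f2 2 hk2 hp0
    have h3 := sum_pow_card_image_le S3 f3 3 hk3 hp0
    have h4 := sum_pow_card_image_le S4 f4 4 hk4 hp0
    have hc2' : (#S2 : ℝ) ≤ distCount E 0 := by exact_mod_cast hc2
    have hc3' : (#S3 : ℝ) ≤ ∑ x ∈ E, ∑ d, (pinCount E x d : ℝ) ^ 2 := by exact_mod_cast hc3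
    have hc4' : (#S4 : ℝ) ≤ ∑ d ∈ univ.erase 0, (distCount E d : ℝ) ^ 2 := by exact_mod_cast hc4
    have m2 := mul_le_mul_of_nonneg_right hc2' (pow_nonneg hp0 2)
    have m3 := mul_le_mul_of_nonneg_right hc3' (pow_nonneg hp0 3)
    have m4 := mul_le_mul_of_nonneg_right hc4' (pow_nonneg hp0 4)
    have u1 := hunion (image f2 S2) (image f3 S3 ∪ image f4 S4)
    have u2 := hunion (image f3 S3) (image f4 S4)
    linarith

end Assembly

/-- With density `δa / N`, where `q = a³` and `N ≥ c a⁴`, each of the three expected counts of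
coincidences is a small multiple of `a`. -/
lemma expected_coincidences_le {a c δ N : ℝ} (ha : 1 ≤ a) (hc : 0 < c) (hδ : 0 < δ)
    (hδ1 : δ ≤ 1) (hN : c * a ^ 4 ≤ N) :
    2 * a ^ 3 * N * (δ * a / N) ^ 2 + (2 * N ^ 3 / a ^ 3 + 2 * N * (a ^ 3) ^ 2) * (δ * a / N) ^ 3 +
      (2 * N ^ 4 / a ^ 3 + 2 * a ^ 3 * N * √(N ^ 3)) * (δ * a / N) ^ 4 ≤
    δ * a * (δ * (2 / c + 2 + 2 / c ^ 2 + 2 + 2 / √(c ^ 3))) := by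
  have ha0 : 0 < a := by linarith
  have hN0 : 0 < N := lt_of_lt_of_le (by positivity) hN
  have hs : 0 < √(N ^ 3) := Real.sqrt_pos.2 (by positivity)
  have hsq : √(N ^ 3) * √(N ^ 3) = N ^ 3 := Real.mul_self_sqrt (by positivity)
  have hsc : 0 < √(c ^ 3) := Real.sqrt_pos.2 (by positivity)
  have hsN : √(c ^ 3) * a ^ 6 ≤ √(N ^ 3) := by
    rw [show √(c ^ 3) * a ^ 6 = √((c * a ^ 4) ^ 3) by
      rw [mul_pow, Real.sqrt_mul (by positivity), show (a ^ 4) ^ 3 = (a ^ 6) ^ 2 by ring,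
        Real.sqrt_sq (by positivity)]]
    exact Real.sqrt_le_sqrt (by gcongr)
  have hδ2 : δ ^ 3 ≤ δ ^ 2 := pow_le_pow_of_le_one hδ.le hδ1 (by norm_num)
  have hδ3 : δ ^ 4 ≤ δ ^ 2 := pow_le_pow_of_le_one hδ.le hδ1 (by norm_num)
  have t1 : 2 * a ^ 3 * N * (δ * a / N) ^ 2 ≤ δ ^ 2 * (2 * a / c) := by
    calc 2 * a ^ 3 * N * (δ * a / N) ^ 2 = δ ^ 2 * (2 * a ^ 5 / N) := by field_simp
      _ ≤ δ ^ 2 * (2 * a ^ 5 / (c * a ^ 4)) := by gcongr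
      _ = _ := by field_simp
  have t2 : 2 * N ^ 3 / a ^ 3 * (δ * a / N) ^ 3 ≤ δ ^ 2 * (2 * a) := by
    calc 2 * N ^ 3 / a ^ 3 * (δ * a / N) ^ 3 = δ ^ 3 * (2 * 1) := by field_simp
      _ ≤ _ := by gcongr
  have t3 : 2 * N * (a ^ 3) ^ 2 * (δ * a / N) ^ 3 ≤ δ ^ 2 * (2 * a / c ^ 2) := by
    calc 2 * N * (a ^ 3) ^ 2 * (δ * a / N) ^ 3 = δ ^ 3 * (2 * a ^ 9 / N ^ 2) := by field_simp
      _ ≤ δ ^ 2 * (2 * a ^ 9 / (c * a ^ 4) ^ 2) := by gcongr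
      _ = _ := by field_simp
  have t4 : 2 * N ^ 4 / a ^ 3 * (δ * a / N) ^ 4 ≤ δ ^ 2 * (2 * a) := by
    calc 2 * N ^ 4 / a ^ 3 * (δ * a / N) ^ 4 = δ ^ 4 * (2 * a) := by field_simp
      _ ≤ _ := by gcongr
  have t5 : 2 * a ^ 3 * N * √(N ^ 3) * (δ * a / N) ^ 4 ≤ δ ^ 2 * (2 * a / √(c ^ 3)) := by
    calc 2 * a ^ 3 * N * √(N ^ 3) * (δ * a / N) ^ 4
        = δ ^ 4 * (2 * a ^ 7 * √(N ^ 3) / N ^ 3) := by field_simp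
      _ = δ ^ 4 * (2 * a ^ 7 / √(N ^ 3)) := by
          have hw : √(N ^ 3) / N ^ 3 = 1 / √(N ^ 3) := by
            rw [div_eq_div_iff (by positivity) hs.ne', hsq, one_mul]
          rw [mul_div_assoc, hw, mul_one_div]
      _ ≤ δ ^ 2 * (2 * a ^ 7 / (√(c ^ 3) * a ^ 6)) := by gcongr
      _ = _ := by field_simp
  have e : δ * a * (δ * (2 / c + 2 + 2 / c ^ 2 + 2 + 2 / √(c ^ 3))) =
      δ ^ 2 * (2 * a / c) + δ ^ 2 * (2 * a) + δ ^ 2 * (2 * a / c ^ 2) + δ ^ 2 * (2 * a) +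
        δ ^ 2 * (2 * a / √(c ^ 3)) := by ring
  rw [e]
  linarith

lemma card_le_of_isDistinctDistanceSet {F : Type*} [Field F] [Fintype F]
    {U : Finset (Fin 2 → F)} (hU : IsDistinctDistanceSet U) :
    (#U : ℝ) ≤ 2 * √(Fintype.card F : ℝ) := by
  classical
  have h1 : #U.offDiag ≤ 2 * Fintype.card F := by
    refine (card_le_mul_card_image (f := fun p => ffNorm (p.1 - p.2)) _ 2 ?_).trans
      (Nat.mul_le_mul_left 2 (card_le_univ _))
    intro d hd
    obtain ⟨⟨x, y⟩, hxy, rfl⟩ := mem_image.1 hd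
    refine (card_le_card (t := {(x, y), (y, x)}) ?_).trans card_le_two
    rintro ⟨z, t⟩ h
    simp only [mem_filter, mem_offDiag] at h hxy
    rcases hU z h.1.1 t h.1.2.1 x hxy.1 y hxy.2.1 h.1.2.2 hxy.2.2 h.2 with ⟨rfl, rfl⟩ | ⟨rfl, rfl⟩
      <;> simp
  rw [offDiag_card] at h1
  have hq : 1 ≤ Fintype.card F := Fintype.card_pos
  have h2 : #U * #U ≤ 4 * Fintype.card F := by
    rcases le_or_gt #U 1 with h | h
    · nlinarith
    · have h3 : 2 * #U ≤ #U * #U := Nat.mul_le_mul_right _ h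
      omega
  have h3 : (#U : ℝ) * #U ≤ 4 * Fintype.card F := by exact_mod_cast h2
  have h4 : √(Fintype.card F : ℝ) * √(Fintype.card F : ℝ) = Fintype.card F :=
    Real.mul_self_sqrt (Nat.cast_nonneg _)
  nlinarith [Real.sqrt_nonneg (Fintype.card F : ℝ)]

/-- The lower bound for subsets of `F × F`, with `a` the cube root of the order of the field. -/
lemma exists_large_distinct {F : Type*} [Field F] [Fintype F] [DecidableEq F] (h2 : (2 : F) ≠ 0)
    {a c δ : ℝ} (ha : 1 ≤ a) (haq : a ^ 3 = Fintype.card F) (hc : 0 < c) (hδ : 0 < δ)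
    (hδ1 : δ ≤ 1) (hδc : δ ≤ c)
    (hδK : δ * (2 / c + 2 + 2 / c ^ 2 + 2 + 2 / √(c ^ 3)) ≤ 1 / 2)
    (E : Finset (F × F)) (hE : c * a ^ 4 ≤ #E) :
    ∃ U ⊆ E,
      (∀ x ∈ U, ∀ y ∈ U, ∀ z ∈ U, ∀ t ∈ U, x ≠ y → z ≠ t → qnorm (x - y) = qnorm (z - t) →
        (x = z ∧ y = t) ∨ (x = t ∧ y = z)) ∧
      δ / 2 * a ≤ #U := by
  have ha0 : 0 < a := by linarith
  have hE0 : (0 : ℝ) < #E := lt_of_lt_of_le (by positivity) hE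
  rcases lt_or_ge #E (Fintype.card F) with hlt | hge
  · -- Here `c * a < 1`, so a single point suffices.
    have hlt' : (#E : ℝ) < a ^ 3 := by rw [haq]; exact_mod_cast hlt
    have hca : c * a < 1 := by
      have : c * a * a ^ 3 < 1 * a ^ 3 := by nlinarith
      exact lt_of_mul_lt_mul_right this (by positivity)
    obtain ⟨v, hv⟩ : E.Nonempty := card_pos.1 (by exact_mod_cast hE0)
    refine ⟨{v}, singleton_subset_iff.2 hv, ?_, ?_⟩
    · intro x hx y hy z _ t _ hxy
      exact absurd ((mem_singleton.1 hx).trans (mem_singleton.1 hy).symm) hxy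
    · rw [card_singleton, Nat.cast_one]
      nlinarith
  · have hp1 : δ * a / #E ≤ 1 := by
      rw [div_le_one hE0]
      refine le_trans ?_ hE
      have : a ≤ a ^ 4 := le_self_pow₀ ha (by norm_num)
      gcongr
    obtain ⟨U, hUE, hU, hcard⟩ := exists_subset_distinct E (p := δ * a / #E) (by positivity) hp1
    refine ⟨U, hUE, hU, le_trans ?_ hcard⟩
    have b2 : (distCount E 0 : ℝ) ≤ 2 * a ^ 3 * #E := by
      rw [haq]; exact_mod_cast distCount_zero_le E
    have b3 := sum_pinCount_sq_le h2 E
    have b4 := sum_distCount_sq_ne_zero_le h2 E hge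
    rw [← haq] at b3 b4
    have hexp := expected_coincidences_le ha hc hδ hδ1 hE
    have hfin : δ * a * (δ * (2 / c + 2 + 2 / c ^ 2 + 2 + 2 / √(c ^ 3))) ≤ δ * a * (1 / 2) := by
      gcongr
    have hp0 : 0 ≤ δ * a / #E := by positivity
    have m2 := mul_le_mul_of_nonneg_right b2 (pow_nonneg hp0 2)
    have m3 := mul_le_mul_of_nonneg_right b3 (pow_nonneg hp0 3)
    have m4 := mul_le_mul_of_nonneg_right b4 (pow_nonneg hp0 4)
    rw [div_mul_cancel₀ _ hE0.ne']
    linarith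

end FiniteFieldDistance

open FiniteFieldDistance

theorem mainTheorem4 :
    ∃ C₂ : ℝ, 0 < C₂ ∧ ∀ c : ℝ, 0 < c → ∃ c₁ : ℝ, 0 < c₁ ∧
      ∀ (F : Type*) [Field F] [Fintype F], Odd (Fintype.card F) →
        ∀ E : Finset (Fin 2 → F),
          c * (Fintype.card F : ℝ) ^ (4 / 3 : ℝ) ≤ (E.card : ℝ) →
          ∃ U : Finset (Fin 2 → F), U ⊆ E ∧ IsDistinctDistanceSet U ∧
            c₁ * (Fintype.card F : ℝ) ^ (1 / 3 : ℝ) ≤ (U.card : ℝ) ∧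
            (U.card : ℝ) ≤ C₂ * (Fintype.card F : ℝ) ^ (1 / 2 : ℝ) := by
  refine ⟨2, two_pos, fun c hc => ?_⟩
  have hK : 0 < 2 / c + 2 + 2 / c ^ 2 + 2 + 2 / √(c ^ 3) := by positivity
  set K := 2 / c + 2 + 2 / c ^ 2 + 2 + 2 / √(c ^ 3) with hKdef
  set δ := min (min 1 c) (1 / (2 * K)) with hδdef
  have hδ : 0 < δ := by positivity
  have hδ1 : δ ≤ 1 := (min_le_left _ _).trans (min_le_left _ _)
  have hδc : δ ≤ c := (min_le_left _ _).trans (min_le_right _ _)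
  have hδK : δ * K ≤ 1 / 2 :=
    (mul_le_mul_of_nonneg_right (min_le_right _ _) hK.le).trans_eq (by field_simp)
  refine ⟨δ / 2, by positivity, fun F _ _ hodd E hE => ?_⟩
  classical
  have h2 : (2 : F) ≠ 0 := Ring.two_ne_zero fun h => by
    have := FiniteField.even_card_of_char_two h
    rw [Nat.odd_iff] at hodd
    omega
  have hq : (1 : ℝ) ≤ Fintype.card F := by exact_mod_cast Fintype.card_pos (α := F)
  have ha : 1 ≤ (Fintype.card F : ℝ) ^ (1 / 3 : ℝ) := Real.one_le_rpow hq (by norm_num)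
  have haq : ((Fintype.card F : ℝ) ^ (1 / 3 : ℝ)) ^ 3 = Fintype.card F := by
    rw [← Real.rpow_natCast, ← Real.rpow_mul (by positivity)]; norm_num
  have ha4 : ((Fintype.card F : ℝ) ^ (1 / 3 : ℝ)) ^ 4 = (Fintype.card F : ℝ) ^ (4 / 3 : ℝ) := by
    rw [← Real.rpow_natCast, ← Real.rpow_mul (by positivity)]; norm_num
  have hnorm : ∀ x y : Fin 2 → F, ffNorm (x - y) =
      qnorm (finTwoArrowEquiv F x - finTwoArrowEquiv F y) := fun x y => by
    simp [ffNorm, qnorm, Fin.sum_univ_two]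
  obtain ⟨U, hUE, hU, hcard⟩ := exists_large_distinct h2 ha haq hc hδ hδ1 hδc hδK
    (E.map (finTwoArrowEquiv F).toEmbedding) (by rw [ha4, Finset.card_map]; exact hE)
  have hdist : IsDistinctDistanceSet (U.map (finTwoArrowEquiv F).symm.toEmbedding) := by
    intro x hx y hy z hz t ht hxy hzt h
    rw [Finset.mem_map_equiv, Equiv.symm_symm] at hx hy hz ht
    have := hU _ hx _ hy _ hz _ ht ((finTwoArrowEquiv F).injective.ne hxy)
      ((finTwoArrowEquiv F).injective.ne hzt)
      (by rw [← hnorm, ← hnorm, h])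
    simpa only [EmbeddingLike.apply_eq_iff_eq] using this
  refine ⟨_, fun x hx => ?_, hdist, ?_, ?_⟩
  · rw [Finset.mem_map_equiv, Equiv.symm_symm] at hx
    have := hUE hx
    rwa [Finset.mem_map_equiv, Equiv.symm_apply_apply] at this
  · rwa [Finset.card_map]
  · rw [← Real.sqrt_eq_rpow]
    exact card_le_of_isDistinctDistanceSet hdist
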